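/- Let $N\ge 3$ be an integer. For a regular $N$-gon put $s_k=\tan(k\pi/N)$ and $\mathrm{scale}[k]=s_1/s_k$ for integers $1\le k<N/2$. Call $\mathrm{scale}[k]$ \emph{primitive} if $\gcd(k,N)=1$. Let $\mathrm{GenScale}[N]=s_1/s_{\langle N/2\rangle}$, where $\langle N/2\rangle$ is the largest integer smaller than $N/2$. Let $\zeta_N=e^{2\pi i/N}$ and let $\mathbb{Q}(\zeta_N)^+=\mathbb{Q}(\zeta_N)\cap\mathbb{R}$ be the maximal real subfield of $\mathbb{Q}(\zeta_N)$. An element $x$ of $\mathbb{Q}(\zeta_N)^+$ is called a \emph{unit generator} of this field if $x$ is a unit of its ring of integers and $\mathbb{Q}(x)=\mathbb{Q}(\zeta_N)^+$. Then: (1) The primitive scales $\mathrm{scale}[k]$, $1\le k<N/2$, $\gcd(k,N)=1$, lie in $\mathbb{Q}(\zeta_N)^+$, form a basis of $\mathbb{Q}(\zeta_N)^+$ over $\mathbb{Q}$, and are units of the ring of integers of $\mathbb{Q}(\zeta_N)^+$. (2) If $N\not\equiv 2 \pmod 4$, then $\mathrm{GenScale}[N]$ is a unit generator of $\mathbb{Q}(\zeta_N)^+$.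 (3) If $N\equiv 2\pmod 4$, then $\mathrm{GenScale}[N/2]$ is a unit generator of $\mathbb{Q}(\zeta_N)^+$. -/

import Mathlib

open scoped NumberField IntermediateField

noncomputable section

/-- The star point `s_k = tan (k π / N)` of a regular `N`-gon (apothem `1`), used for `1 ≤ k < N / 2`. -/
def starPoint (N k : ℕ) : ℝ := Real.tan (k * Real.pi / N)

/-- The scale `scale[k] = s_1 / s_k` of a regular `N`-gon. -/
def scale (N k : ℕ) : ℝ := starPoint N 1 / starPoint N k

/-- The largest integer `k < N / 2` (see `isGreatest_lastIndex`). -/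
def lastIndex (N : ℕ) : ℕ := (N - 1) / 2

theorem isGreatest_lastIndex (N : ℕ) (hN : 1 ≤ N) :
    IsGreatest {k : ℕ | (k : ℝ) < (N : ℝ) / 2} (lastIndex N) := by
  have key : ∀ k : ℕ, (k : ℝ) < (N : ℝ) / 2 ↔ 2 * k < N := by
    intro k
    rw [lt_div_iff₀ (by norm_num)]
    constructor
    · intro h
      have h' : ((k * 2 : ℕ) : ℝ) < (N : ℝ) := by exact_mod_cast h
      have := Nat.cast_lt.mp h'
      omega
    · intro h
      have : k * 2 < N := by omega
      exact_mod_cast this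
  unfold lastIndex
  constructor
  · simp only [Set.mem_ofPred_eq, key]
    omega
  · intro k hk
    simp only [Set.mem_ofPred_eq, key] at hk
    omega

/-- `GenScale[N]`: the scale whose index is the largest integer below `N / 2`. -/
def genScale (N : ℕ) : ℝ := scale N (lastIndex N)

/-- The indices of the primitive scales: `1 ≤ k < N / 2` and `gcd (k, N) = 1`. -/
abbrev PrimitiveIndex (N : ℕ) : Type :=
  {k : ℕ // 1 ≤ k ∧ (k : ℝ) < (N : ℝ) / 2 ∧ Nat.Coprime k N}

/-- The `N`-th cyclotomic field `ℚ(ζ_N)` inside `ℂ`, with `ζ_N = exp (2 π i / N)`. -/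
def cyclotomicSubfield (N : ℕ) : IntermediateField ℚ ℂ :=
  ℚ⟮Complex.exp (2 * Real.pi * Complex.I / N)⟯

/-- The maximal real subfield `ℚ(ζ_N)⁺ = ℚ(ζ_N) ∩ ℝ`, as a subfield of `ℝ`. -/
def realCyclotomicSubfield (N : ℕ) : IntermediateField ℚ ℝ :=
  (cyclotomicSubfield N).comap (Complex.ofRealAm.restrictScalars ℚ)

theorem mem_realCyclotomicSubfield (N : ℕ) (x : ℝ) :
    x ∈ realCyclotomicSubfield N ↔ (x : ℂ) ∈ cyclotomicSubfield N := Iff.rfl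

/-- `ℚ(ζ_N) ∩ ℝ` is the maximal real subfield of the number field `ℚ(ζ_N)` in the abstract sense. -/
theorem mem_realCyclotomicSubfield_iff_maximalReal (N : ℕ) (hN : 3 ≤ N) (x : ℝ) :
    x ∈ realCyclotomicSubfield N ↔
      ∃ y : cyclotomicSubfield N,
        y ∈ NumberField.maximalRealSubfield (cyclotomicSubfield N) ∧ (y : ℂ) = x := by
  constructor
  · intro h
    refine ⟨⟨x, h⟩, ?_, rfl⟩
    intro φ
    have : NeZero N := ⟨by omega⟩
    have hz := Complex.isPrimitiveRoot_exp N (by omega)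
    have : IsCyclotomicExtension {N} ℚ (cyclotomicSubfield N) := by
      have : IsCyclotomicExtension {N} ℚ
          (Algebra.adjoin ℚ {Complex.exp (2 * Real.pi * Complex.I / N)}) :=
        hz.adjoin_isCyclotomicExtension ℚ
      have e : (cyclotomicSubfield N).toSubalgebra =
          Algebra.adjoin ℚ {Complex.exp (2 * Real.pi * Complex.I / N)} :=
        IntermediateField.adjoin_simple_toSubalgebra_of_isAlgebraic
          ((hz.isIntegral (by omega)).tower_top (A := ℚ)).isAlgebraic
      exact IsCyclotomicExtension.equiv {N} ℚ _ (Subalgebra.equivOfEq _ _ e.symm)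
    have : NumberField (cyclotomicSubfield N) := IsCyclotomicExtension.numberField {N} ℚ _
    have : NumberField.IsCMField (cyclotomicSubfield N) :=
      IsCyclotomicExtension.Rat.isCMField (S := {N}) _ ⟨N, rfl, by omega⟩
    have h1 := NumberField.IsCMField.complexEmbedding_complexConj
      (K := cyclotomicSubfield N) φ ⟨x, h⟩
    have h2 := NumberField.IsCMField.complexEmbedding_complexConj
      (K := cyclotomicSubfield N) (algebraMap _ ℂ) ⟨x, h⟩
    have h3 : NumberField.IsCMField.complexConj (cyclotomicSubfield N) ⟨x, h⟩ = ⟨x, h⟩ := by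
      apply (algebraMap (cyclotomicSubfield N) ℂ).injective
      rw [h2]
      exact Complex.conj_ofReal x
    rw [h3] at h1
    exact h1.symm
  · rintro ⟨y, -, hy⟩
    rw [mem_realCyclotomicSubfield, ← hy]
    exact y.2

/-- `x` is an algebraic unit of `K`: a unit of the ring of integers of `K`. -/
def IsAlgebraicUnitOf (K : IntermediateField ℚ ℝ) (x : ℝ) : Prop :=
  ∃ u : (𝓞 K)ˣ, ((algebraMap (𝓞 K) K (u : 𝓞 K) : K) : ℝ) = x

/-- `x` is a unit generator of `K`: an algebraic unit of `K` with `ℚ(x) = K`. -/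
def IsUnitGeneratorOf (K : IntermediateField ℚ ℝ) (x : ℝ) : Prop :=
  IsAlgebraicUnitOf K x ∧ ℚ⟮x⟯ = K

end

/-!
Since `scale[k] = s_1 cot (k π / N)`, the linear independence of the primitive scales is that of
the cotangents `cot (k π / N)` with `k < N / 2` coprime to `N` (a theorem of Chowla and Okada).
Up to the factor `-i`, these are the numbers `x(k) = (ζ ^ k + 1) / (ζ ^ k - 1)` of `ℚ(ζ)`,
`ζ = exp (2 π i / N)`. A rational relation `∑ c_k x(k) = 0` persists under the Galois conjugations,
so `∑ c_k x(k t) = 0` for all units `t` modulo `N`. Summing against an odd Dirichlet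
character `χ` gives `(∑ c_k χ(k)⁻¹) (∑ χ(b) x(b)) = 0`. The second factor is a nonzero
multiple of `L(1, χ)`, by the partial fraction expansion of the cotangent
(`hurwitzZetaOdd_one`, `DirichletCharacter.Odd.sum_mul_cot_ne_zero`), so the first one vanishes
for all odd `χ`; orthogonality of characters then gives `c = 0` (`linearIndependent_cotRatio`).

The primitive indices together with their negatives exhaust the units modulo `N`, and `ℚ(ζ)`
contains `K ⊕ K ζ` for `K = ℚ(ζ)⁺`, so there are at least `[K : ℚ]` primitive scales and they form
a basis. They are units because they are products of cyclotomic units `(ω ^ k - 1) / (ω - 1)` and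
their inverses, with `ω = ± ζ` (`isIntegral_scale_and_inv`).

Finally `K = ℚ(cos (2π / N))`, and `cos (2π / N)` is a rational function of `GenScale[N]`, because
`GenScale[N]` is `1 / cos (π / N) - 1` for odd `N` and `tan² (π / N)` for `4 ∣ N`. When
`N ≡ 2 mod 4` the fields for `N` and `N / 2` coincide.
-/

open Filter Topology HurwitzZeta
open scoped NumberField IntermediateField

/-! ### The value of odd Dirichlet `L`-functions at `1` -/

/-- Mean value estimate for `x ↦ x ^ (-s)`; it makes the paired series for `hurwitzZetaOdd`
converge uniformly as `s → 1⁺`. -/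
theorem abs_one_div_rpow_sub_one_div_rpow_le {s m x y : ℝ} (hs : 0 ≤ s) (hm : 0 < m)
    (hx : m ≤ x) (hy : m ≤ y) :
    |1 / x ^ s - 1 / y ^ s| ≤ s * m ^ (-s - 1) * |x - y| := by
  have h := (convex_Ici m).norm_image_sub_le_of_norm_hasDerivWithin_le
    (f := fun t : ℝ => t ^ (-s)) (f' := fun t => -s * t ^ (-s - 1)) (C := s * m ^ (-s - 1))
    (fun t ht => (Real.hasDerivAt_rpow_const
      (Or.inl (hm.trans_le ht).ne')).hasDerivWithinAt)
    (fun t ht => by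
      have ht' : m ≤ t := ht
      rw [norm_mul, Real.norm_eq_abs, Real.norm_eq_abs, abs_neg, abs_of_nonneg hs,
        abs_of_nonneg (Real.rpow_nonneg (hm.le.trans ht') _)]
      exact mul_le_mul_of_nonneg_left
        (Real.rpow_le_rpow_of_nonpos hm ht' (by linarith)) hs)
    (show y ∈ Set.Ici m from hy) (show x ∈ Set.Ici m from hx)
  simpa [Real.rpow_neg (hm.le.trans hx), Real.rpow_neg (hm.le.trans hy), one_div] using h

/-- The paired series for `hurwitzZetaOdd a 1` sums to a cotangent. -/
theorem hasSum_one_div_add_sub_one_div_cot {a : ℝ} (ha : a ∈ Set.Ioo (0 : ℝ) 1)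
    (hsum : Summable fun n : ℕ => 1 / ((n : ℝ) + a) - 1 / (n + 1 - a)) :
    HasSum (fun n : ℕ => 1 / ((n : ℝ) + a) - 1 / (n + 1 - a))
      (Real.pi * Real.cot (Real.pi * a)) := by
  have hmem : (a : ℂ) ∈ Complex.integerComplement := by
    rintro ⟨n, hn⟩
    have hn' : (n : ℝ) = a := by exact_mod_cast hn
    obtain ⟨h0, h1⟩ := ha
    rw [← hn'] at h0 h1
    have h0' : 0 < n := by exact_mod_cast h0
    have h1' : n < 1 := by exact_mod_cast h1
    omega
  have h := tendsto_logDeriv_euler_cot_sub hmem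
  have h2 : Tendsto (fun n : ℕ => ∑ j ∈ Finset.range n, (1 / (a - (j + 1)) + 1 / (a + (j + 1))))
      atTop (𝓝 (Real.pi * Real.cot (Real.pi * a) - 1 / a)) := by
    have h3 := (Complex.continuous_re.tendsto _).comp h
    have e : ((Real.pi : ℂ) * Complex.cot (Real.pi * a) - 1 / a) =
        ((Real.pi * Real.cot (Real.pi * a) - 1 / a : ℝ) : ℂ) := by push_cast; rfl
    rw [e, Complex.ofReal_re] at h3
    refine h3.congr fun n => ?_
    have e2 : (∑ j ∈ Finset.range n, cotTerm (a : ℂ) j) =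
        ((∑ j ∈ Finset.range n, (1 / (a - (j + 1)) + 1 / (a + (j + 1))) : ℝ) : ℂ) := by
      push_cast [cotTerm]; rfl
    rw [Function.comp_apply, e2, Complex.ofReal_re]
  -- Pairing `a + n` with `a - (n + 1)` or with `a + (n + 1)` changes the partial sums only by the
  -- unpaired first term `1 / a` and a boundary term tending to `0`.
  have key : ∀ n : ℕ, ∑ j ∈ Finset.range n, (1 / ((j : ℝ) + a) - 1 / (j + 1 - a)) =
      ∑ j ∈ Finset.range n, (1 / (a - (j + 1)) + 1 / (a + (j + 1))) + 1 / a - 1 / (a + n) := by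
    intro n
    induction n with
    | zero => simp
    | succ n ih =>
      rw [Finset.sum_range_succ, Finset.sum_range_succ, ih]
      have : 1 / (a - ((n : ℝ) + 1)) = - (1 / (n + 1 - a)) := by
        rw [← neg_sub, one_div, one_div, inv_neg]
      rw [this]
      push_cast
      ring
  have h4 : Tendsto (fun n : ℕ => 1 / (a + (n : ℝ))) atTop (𝓝 0) := by
    simp only [one_div]
    exact tendsto_inv_atTop_zero.comp (tendsto_atTop_add_const_left _ _ tendsto_natCast_atTop_atTop)
  rw [hsum.hasSum_iff_tendsto_nat]
  simp only [key]
  have := (h2.add_const (1 / a)).sub h4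
  simpa using this

/-- The value of the odd Hurwitz zeta function at `s = 1`. The Dirichlet series is only available
for `1 < re s`; the value is its limit as `s → 1⁺`, taken termwise by dominated convergence. -/
theorem hurwitzZetaOdd_one {a : ℝ} (ha : a ∈ Set.Ioo (0 : ℝ) 1) :
    hurwitzZetaOdd a 1 = ((Real.pi / 2 * Real.cot (Real.pi * a) : ℝ) : ℂ) := by
  obtain ⟨h0, h1⟩ := ha
  set f : ℝ → ℕ → ℝ := fun s n => 1 / ((n : ℝ) + a) ^ s - 1 / ((n : ℝ) + 1 - a) ^ s with hf
  set m := min a (1 - a) with hm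
  have hm0 : 0 < m := lt_min h0 (by linarith)
  set bound : ℕ → ℝ := fun n => if n = 0 then 2 * m ^ (-3 : ℝ) else 2 * (n : ℝ) ^ (-2 : ℝ) with hb
  have hbs : Summable bound := by
    have h := (Real.summable_nat_rpow (p := -2)).2 (by norm_num) |>.mul_left 2
    rw [← summable_nat_add_iff 1] at h ⊢
    exact h.congr fun n => by simp [hb]
  have hbd : ∀ s ∈ Set.Icc (1 : ℝ) 2, ∀ n, ‖f s n‖ ≤ bound n := by
    rintro s ⟨hs1, hs2⟩ n
    rw [Real.norm_eq_abs]
    have hd : |((n : ℝ) + a) - (n + 1 - a)| ≤ 1 := by rw [abs_le]; constructor <;> linarith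
    by_cases hn : n = 0
    · subst hn
      have hx : m ≤ ((0 : ℕ) : ℝ) + a := by simp [hm]
      have hy : m ≤ ((0 : ℕ) : ℝ) + 1 - a := by simp [hm]
      refine (abs_one_div_rpow_sub_one_div_rpow_le (by linarith) hm0 hx hy).trans ?_
      have hm1 : m ≤ 1 := (min_le_left _ _).trans h1.le
      have : m ^ (-s - 1) ≤ m ^ (-3 : ℝ) :=
        Real.rpow_le_rpow_of_exponent_ge hm0 hm1 (by linarith)
      have hp : 0 ≤ m ^ (-s - 1) := Real.rpow_nonneg hm0.le _
      simp only [hb, if_true]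
      calc s * m ^ (-s - 1) * |_| ≤ s * m ^ (-s - 1) * 1 := by gcongr
        _ ≤ 2 * m ^ (-3 : ℝ) := by rw [mul_one]; gcongr
    · have hn1 : (1 : ℝ) ≤ n := by exact_mod_cast Nat.one_le_iff_ne_zero.2 hn
      have hx : (n : ℝ) ≤ n + a := by linarith
      have hy : (n : ℝ) ≤ n + 1 - a := by linarith
      refine (abs_one_div_rpow_sub_one_div_rpow_le (by linarith) (by linarith) hx hy).trans ?_
      have : (n : ℝ) ^ (-s - 1) ≤ (n : ℝ) ^ (-2 : ℝ) :=
        Real.rpow_le_rpow_of_exponent_le hn1 (by linarith)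
      simp only [hb, if_neg hn]
      calc s * (n : ℝ) ^ (-s - 1) * |_| ≤ s * (n : ℝ) ^ (-s - 1) * 1 := by gcongr
        _ ≤ 2 * (n : ℝ) ^ (-2 : ℝ) := by rw [mul_one]; gcongr
  have hpos1 : ∀ n : ℕ, 0 < (n : ℝ) + a := fun n => by positivity
  have hpos2 : ∀ n : ℕ, 0 < (n : ℝ) + 1 - a := fun n => by
    have : (0 : ℝ) ≤ n := n.cast_nonneg
    linarith
  have hlim : Tendsto (fun s => ∑' n, f s n) (𝓝[>] 1) (𝓝 (∑' n, f 1 n)) := by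
    refine tendsto_tsum_of_dominated_convergence hbs (fun n => ?_) ?_
    · have : ContinuousAt (fun s => f s n) 1 := by
        have c1 := (Real.continuous_const_rpow (hpos1 n).ne').continuousAt (x := 1)
        have c2 := (Real.continuous_const_rpow (hpos2 n).ne').continuousAt (x := 1)
        exact (continuousAt_const.div c1 (Real.rpow_pos_of_pos (hpos1 n) _).ne').sub
          (continuousAt_const.div c2 (Real.rpow_pos_of_pos (hpos2 n) _).ne')
      exact this.tendsto.mono_left nhdsWithin_le_nhds
    · filter_upwards [Ioc_mem_nhdsGT (show (1 : ℝ) < 2 by norm_num)] with s hs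
      exact hbd s ⟨hs.1.le, hs.2⟩
  have hone : ∑' n, f 1 n = Real.pi * Real.cot (Real.pi * a) := by
    have hs : Summable (f 1) := Summable.of_norm_bounded hbs (hbd 1 (by norm_num))
    have e : f 1 = fun n : ℕ => 1 / ((n : ℝ) + a) - 1 / (n + 1 - a) := by
      ext n; simp [hf]
    rw [e] at hs ⊢
    exact (hasSum_one_div_add_sub_one_div_cot ⟨h0, h1⟩ hs).tsum_eq
  have hser : ∀ s : ℝ, 1 < s → hurwitzZetaOdd a s = ((1 / 2 * ∑' n, f s n : ℝ) : ℂ) := by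
    intro s hs
    have h := hasSum_nat_hurwitzZetaOdd_of_mem_Icc (a := a) ⟨h0.le, h1.le⟩ (s := s)
      (by simpa using hs)
    rw [← h.tsum_eq, ← tsum_mul_left, Complex.ofReal_tsum]
    refine tsum_congr fun n => ?_
    simp only [hf]
    push_cast
    rw [Complex.ofReal_cpow (hpos1 n).le, Complex.ofReal_cpow (hpos2 n).le]
    push_cast
    ring
  have hL : Tendsto (fun s : ℝ => hurwitzZetaOdd a s) (𝓝[>] 1) (𝓝 (hurwitzZetaOdd a 1)) := by
    have c : Continuous fun s : ℝ => hurwitzZetaOdd a s :=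
      (differentiable_hurwitzZetaOdd a).continuous.comp Complex.continuous_ofReal
    have := (c.tendsto 1).mono_left (nhdsWithin_le_nhds (s := Set.Ioi 1))
    simpa using this
  have hR : Tendsto (fun s : ℝ => hurwitzZetaOdd a s) (𝓝[>] 1)
      (𝓝 ((1 / 2 * (Real.pi * Real.cot (Real.pi * a)) : ℝ) : ℂ)) := by
    have h5 := (Complex.continuous_ofReal.tendsto _).comp ((hone ▸ hlim).const_mul (1 / 2))
    refine h5.congr' ?_
    filter_upwards [self_mem_nhdsWithin] with s hs
    exact (hser s hs).symm
  rw [tendsto_nhds_unique hL hR]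
  push_cast
  ring

/-- For an odd Dirichlet character `χ`, the twisted cotangent sum is a nonzero multiple of
`L(1, χ)`, hence nonzero. -/
theorem DirichletCharacter.Odd.sum_mul_cot_ne_zero {N : ℕ} [NeZero N]
    {χ : DirichletCharacter ℂ N} (hχ : χ.Odd) :
    ∑ j : ZMod N, χ j * Real.cot (Real.pi * (j.val / N)) ≠ 0 := by
  have hodd : Function.Odd (χ : ZMod N → ℂ) := hχ.to_fun
  have hχ1 : χ ≠ 1 := by
    rintro rfl
    have h1 : (1 : DirichletCharacter ℂ N) (-1) = -1 := hχ
    rw [MulChar.one_apply (isUnit_one.neg)] at h1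
    norm_num at h1
  have hL := DirichletCharacter.LFunction_apply_one_ne_zero hχ1
  rw [DirichletCharacter.LFunction, ZMod.LFunction_def_odd hodd] at hL
  have hN : (0 : ℝ) < N := Nat.cast_pos.2 (NeZero.pos N)
  have e : ∑ j : ZMod N, χ j * hurwitzZetaOdd (ZMod.toAddCircle j) 1 =
      (Real.pi / 2 : ℝ) * ∑ j : ZMod N, χ j * Real.cot (Real.pi * (j.val / N)) := by
    rw [Finset.mul_sum]
    refine Finset.sum_congr rfl fun j _ => ?_
    by_cases hj : j = 0
    · have : χ 0 = 0 := by
        have := hodd 0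
        rw [neg_zero] at this
        exact self_eq_neg.1 this
      simp [hj, this]
    · have h1 : 0 < j.val := Nat.pos_of_ne_zero (by simpa using hj)
      have h2 : j.val < N := ZMod.val_lt j
      rw [ZMod.toAddCircle_apply, hurwitzZetaOdd_one ⟨by positivity, by
        rw [div_lt_one hN]; exact_mod_cast h2⟩]
      push_cast
      ring
  rw [e] at hL
  exact right_ne_zero_of_mul (right_ne_zero_of_mul hL)

/-! ### Linear independence of cotangents over `ℚ` -/

/-- Conjugation in a cyclotomic field: `ζ ↦ ζ ^ t` for `t` coprime to the order of `ζ`. -/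
theorem IsPrimitiveRoot.exists_algHom_adjoin_apply_eq_pow {N : ℕ} [NeZero N] {ζ : ℂ}
    (hζ : IsPrimitiveRoot ζ N) {t : ℕ} (ht : t.Coprime N) :
    ∃ σ : ℚ⟮ζ⟯ →ₐ[ℚ] ℂ, σ (IntermediateField.AdjoinSimple.gen ℚ ζ) = ζ ^ t := by
  have hN : 0 < N := NeZero.pos N
  have hint : IsIntegral ℚ ζ := (hζ.isIntegral hN).tower_top
  have hroot : ζ ^ t ∈ (minpoly ℚ ζ).aroots ℂ := by
    rw [Polynomial.mem_aroots, ← Polynomial.cyclotomic_eq_minpoly_rat hζ hN]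
    refine ⟨Polynomial.cyclotomic_ne_zero _ _, ?_⟩
    rw [Polynomial.aeval_def, Polynomial.eval₂_eq_eval_map, Polynomial.map_cyclotomic]
    exact (hζ.pow_of_coprime t ht).isRoot_cyclotomic hN
  exact ⟨(IntermediateField.algHomAdjoinIntegralEquiv ℚ hint).symm ⟨_, hroot⟩,
    IntermediateField.algHomAdjoinIntegralEquiv_symm_apply_gen ℚ hint ⟨_, hroot⟩⟩

/-- `-i cot (π a / N)` as a function of the residue class `a`, written as a rational function of
a root of unity. -/
noncomputable def cotRatio {N : ℕ} [NeZero N] (a : ZMod N) : ℂ :=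
  (ZMod.stdAddChar a + 1) / (ZMod.stdAddChar a - 1)

theorem cotRatio_eq_cot {N : ℕ} [NeZero N] (a : ZMod N) :
    cotRatio a = -Complex.I * Real.cot (Real.pi * (a.val / N)) := by
  have e : (ZMod.stdAddChar a : ℂ) = Complex.exp (2 * Real.pi * Complex.I * (a.val / N : ℝ)) := by
    conv_lhs => rw [← ZMod.natCast_zmod_val a, ← Int.cast_natCast, ZMod.stdAddChar_coe]
    push_cast
    congr 1
    ring
  rw [cotRatio, e, Complex.ofReal_cot, Complex.ofReal_mul, Complex.cot_pi_eq_exp_ratio,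
    mul_comm Complex.I, ← div_div, ← mul_div_assoc, ← mul_div_assoc, ← neg_sub, div_neg]
  field_simp

/-- A rational linear relation among the `cotRatio a` is preserved by multiplying all indices by
a unit: apply a Galois conjugation of `ℚ(ζ_N)`. -/
theorem sum_mul_cotRatio_mul_unit_eq_zero {N : ℕ} [NeZero N] {ι : Type*} [Fintype ι]
    (v : ι → ZMod N) (c : ι → ℚ) (h : ∑ i, (c i : ℂ) * cotRatio (v i) = 0) (t : (ZMod N)ˣ) :
    ∑ i, (c i : ℂ) * cotRatio (v i * (t : ZMod N)) = 0 := by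
  have hζ : IsPrimitiveRoot (ZMod.stdAddChar (1 : ZMod N) : ℂ) N := by
    have := Complex.isPrimitiveRoot_exp N (NeZero.ne N)
    have e := ZMod.stdAddChar_coe (N := N) 1
    simp only [Int.cast_one, mul_one] at e
    rwa [e]
  set ζ : ℂ := ZMod.stdAddChar (1 : ZMod N) with hζdef
  have hpow : ∀ a : ZMod N, (ZMod.stdAddChar a : ℂ) = ζ ^ a.val := fun a => by
    rw [hζdef, ← AddChar.map_nsmul_eq_pow]
    simp
  obtain ⟨σ, hσ⟩ := hζ.exists_algHom_adjoin_apply_eq_pow (ZMod.val_coe_unit_coprime t)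
  set g := IntermediateField.AdjoinSimple.gen ℚ ζ
  have hg : algebraMap ℚ⟮ζ⟯ ℂ g = ζ := IntermediateField.AdjoinSimple.algebraMap_gen ℚ ζ
  have h0 : ∑ i, algebraMap ℚ ℚ⟮ζ⟯ (c i) * ((g ^ (v i).val + 1) / (g ^ (v i).val - 1)) = 0 := by
    apply (algebraMap ℚ⟮ζ⟯ ℂ).injective
    rw [map_sum, map_zero, ← h]
    refine Finset.sum_congr rfl fun i _ => ?_
    rw [map_mul, ← IsScalarTower.algebraMap_apply, map_div₀, map_add, map_sub, map_pow, hg,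
      map_one, cotRatio, hpow]
    simp
  have h1 := congrArg σ h0
  rw [map_sum, map_zero] at h1
  rw [← h1]
  refine Finset.sum_congr rfl fun i _ => ?_
  rw [map_mul, AlgHom.commutes, map_div₀, map_add, map_sub, map_pow, hσ, map_one, cotRatio,
    ← hpow, ← AddChar.map_nsmul_eq_pow]
  simp [nsmul_eq_mul]

/-- Cotangents at units `v i` of `ℤ/N`, no two of which are equal or opposite, are linearly
independent over `ℚ`. After a relation is conjugated and averaged against an odd character `χ`,
it factors as `(∑ c i χ(v i)⁻¹) (∑ χ(b) cotRatio b)`, whose second factor is a nonzero multiple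
of `L(1, χ)`; orthogonality of characters then isolates each coefficient. -/
theorem linearIndependent_cotRatio {N : ℕ} [NeZero N] {ι : Type*} [Finite ι]
    (v : ι → (ZMod N)ˣ) (hv : Function.Injective v) (hv' : ∀ i j, v i ≠ -v j) :
    LinearIndependent ℚ fun i => cotRatio (v i : ZMod N) := by
  classical
  have := Fintype.ofFinite ι
  rw [Fintype.linearIndependent_iff]
  intro c hc
  have hc0 : ∑ i, (c i : ℂ) * cotRatio (v i : ZMod N) = 0 := by
    rw [← hc]
    exact Finset.sum_congr rfl fun i _ => by rw [Rat.smul_def]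
  have hconj := sum_mul_cotRatio_mul_unit_eq_zero (fun i => (v i : ZMod N)) c hc0
  have hχ : ∀ χ : DirichletCharacter ℂ N,
      (1 - χ (-1)) * ∑ i, (c i : ℂ) * χ ((v i)⁻¹ : (ZMod N)ˣ) = 0 := by
    intro χ
    rcases χ.even_or_odd with he | ho
    · rw [he]; simp
    have hS : ∑ b : (ZMod N)ˣ, χ b * cotRatio (b : ZMod N) ≠ 0 := by
      have := ho.sum_mul_cot_ne_zero
      rw [← Fintype.sum_of_injective (fun b : (ZMod N)ˣ => (b : ZMod N)) Units.val_injective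
        (fun b => χ b * Real.cot (Real.pi * ((b : ZMod N).val / N))) _
        (fun j hj => by
          rw [MulChar.map_nonunit χ (fun h => hj ⟨h.unit, rfl⟩), zero_mul]) (fun _ => rfl)] at this
      simp only [cotRatio_eq_cot]
      rw [show ∑ b : (ZMod N)ˣ, χ b * (-Complex.I * Real.cot (Real.pi * ((b : ZMod N).val / N))) =
        -Complex.I * ∑ b : (ZMod N)ˣ, χ b * Real.cot (Real.pi * ((b : ZMod N).val / N)) by
          rw [Finset.mul_sum]; exact Finset.sum_congr rfl fun _ _ => by ring]
      exact mul_ne_zero (neg_ne_zero.2 Complex.I_ne_zero) this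
    have hprod : (∑ i, (c i : ℂ) * χ ((v i)⁻¹ : (ZMod N)ˣ)) *
        ∑ b : (ZMod N)ˣ, χ b * cotRatio (b : ZMod N) = 0 := by
      calc _ = ∑ i, ∑ t : (ZMod N)ˣ,
            χ t * ((c i : ℂ) * cotRatio ((v i : ZMod N) * (t : ZMod N))) := by
            rw [Finset.sum_mul]
            refine Finset.sum_congr rfl fun i _ => ?_
            rw [Finset.mul_sum]
            refine (Fintype.sum_equiv (Equiv.mulLeft (v i)) _ _ fun t => ?_).symm
            rw [Equiv.coe_mulLeft, Units.val_mul, map_mul]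
            have : χ ((v i)⁻¹ : (ZMod N)ˣ) * χ (v i) = 1 := by
              rw [← map_mul, Units.inv_mul, map_one]
            linear_combination
              (- (χ t * (c i : ℂ) * cotRatio ((v i : ZMod N) * (t : ZMod N)))) * this
        _ = ∑ t : (ZMod N)ˣ, χ t * ∑ i, (c i : ℂ) * cotRatio ((v i : ZMod N) * (t : ZMod N)) := by
            rw [Finset.sum_comm]
            exact Finset.sum_congr rfl fun t _ => by rw [Finset.mul_sum]
        _ = 0 := Finset.sum_eq_zero fun t _ => by rw [hconj t, mul_zero]
    rw [(mul_eq_zero.1 hprod).resolve_right hS, mul_zero]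
  intro k
  have horth : ∀ i, ∀ b : (ZMod N)ˣ, ∑ χ : DirichletCharacter ℂ N,
      χ ((v i)⁻¹ : (ZMod N)ˣ) * χ b = if v i = b then (N.totient : ℂ) else 0 := by
    intro i b
    have := DirichletCharacter.sum_char_inv_mul_char_eq ℂ (v i).isUnit (b : ZMod N)
    rw [ZMod.inv_coe_unit] at this
    rw [this]
    simp only [Units.ext_iff]
  have hsum : (N.totient : ℂ) * c k = 0 := by
    calc (N.totient : ℂ) * c k
        = ∑ i, (c i : ℂ) * ((if v i = v k then (N.totient : ℂ) else 0) -
            if v i = -v k then (N.totient : ℂ) else 0) := by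
          simp only [hv' _ k, if_false, sub_zero, hv.eq_iff, mul_ite, mul_zero]
          rw [Finset.sum_ite_eq' Finset.univ k, if_pos (Finset.mem_univ k), mul_comm]
      _ = ∑ χ : DirichletCharacter ℂ N, χ (v k) *
            ((1 - χ (-1)) * ∑ i, (c i : ℂ) * χ ((v i)⁻¹ : (ZMod N)ˣ)) := by
          simp only [← horth, ← Finset.sum_sub_distrib, Finset.mul_sum]
          rw [Finset.sum_comm]
          refine Finset.sum_congr rfl fun χ _ => Finset.sum_congr rfl fun i _ => ?_
          rw [Units.val_neg, neg_eq_neg_one_mul, map_mul]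
          ring
      _ = 0 := Finset.sum_eq_zero fun χ _ => by rw [hχ χ, mul_zero]
  have hφ : (N.totient : ℂ) ≠ 0 :=
    Nat.cast_ne_zero.2 (Nat.totient_pos.2 (NeZero.pos N)).ne'
  exact_mod_cast (mul_eq_zero.1 hsum).resolve_left hφ

/-! ### Scales as rational functions of a root of unity -/

theorem Complex.ofReal_tan_eq_exp_ratio (θ : ℝ) :
    (Real.tan θ : ℂ) = -Complex.I *
      ((Complex.exp (2 * Complex.I * θ) - 1) / (Complex.exp (2 * Complex.I * θ) + 1)) := by
  rw [Complex.ofReal_tan, ← Complex.cot_inv_eq_tan, Complex.cot_eq_exp_ratio, inv_div, ← neg_sub,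
    mul_neg, neg_div, neg_mul, mul_div_assoc]

theorem ofReal_starPoint (N k : ℕ) :
    (starPoint N k : ℂ) = -Complex.I * ((Complex.exp (2 * Real.pi * Complex.I / N) ^ k - 1) /
      (Complex.exp (2 * Real.pi * Complex.I / N) ^ k + 1)) := by
  have e : Complex.exp (2 * Real.pi * Complex.I / N) ^ k =
      Complex.exp (2 * Complex.I * (k * Real.pi / N : ℝ)) := by
    rw [← Complex.exp_nat_mul]
    congr 1
    push_cast
    ring
  rw [e, ← Complex.ofReal_tan_eq_exp_ratio, starPoint]

theorem ofReal_scale (N k : ℕ) :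
    (scale N k : ℂ) =
      ((Complex.exp (2 * Real.pi * Complex.I / N) - 1) /
        (Complex.exp (2 * Real.pi * Complex.I / N) + 1)) *
      ((Complex.exp (2 * Real.pi * Complex.I / N) ^ k + 1) /
        (Complex.exp (2 * Real.pi * Complex.I / N) ^ k - 1)) := by
  rw [scale, Complex.ofReal_div, ofReal_starPoint, ofReal_starPoint, pow_one,
    mul_div_mul_left _ _ (neg_ne_zero.2 Complex.I_ne_zero), div_eq_mul_inv, inv_div]

theorem scale_mem_realCyclotomicSubfield (N k : ℕ) : scale N k ∈ realCyclotomicSubfield N := by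
  rw [mem_realCyclotomicSubfield, ofReal_scale]
  have h : Complex.exp (2 * Real.pi * Complex.I / N) ∈ cyclotomicSubfield N :=
    IntermediateField.mem_adjoin_simple_self ℚ _
  have h1 : (1 : ℂ) ∈ cyclotomicSubfield N := one_mem _
  exact mul_mem (div_mem (sub_mem h h1) (add_mem h h1))
    (div_mem (add_mem (pow_mem h k) h1) (sub_mem (pow_mem h k) h1))

/-! ### Primitive scales are units -/

theorem IsIntegral.pow_sub_one_div_sub_one {ω : ℂ} (hω : IsIntegral ℤ ω) (k : ℕ) :
    IsIntegral ℤ ((ω ^ k - 1) / (ω - 1)) := by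
  by_cases h : ω = 1
  -- Here the quotient is `0 / 0 = 0`.
  · simpa [h] using isIntegral_zero
  · rw [← geom_sum_eq h]
    exact IsIntegral.sum _ fun i _ => hω.pow i

/-- The cyclotomic unit `(ω ^ k - 1) / (ω - 1)`, for `k` coprime to the order of `ω`, has integral
inverse because `ω` is in turn a power of `ω ^ k`. -/
theorem isIntegral_sub_one_div_pow_sub_one {ω : ℂ} {n k : ℕ} (hn : n ≠ 0) (hω : ω ^ n = 1)
    (hk : k.Coprime n) : IsIntegral ℤ ((ω - 1) / (ω ^ k - 1)) := by
  obtain ⟨m, hm⟩ := exists_pow_eq_self_of_coprime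
    (hk.coprime_dvd_right (orderOf_dvd_of_pow_eq_one hω))
  have hint : IsIntegral ℤ ω := IsIntegral.of_pow (Nat.pos_of_ne_zero hn) (hω ▸ isIntegral_one)
  have := (hint.pow k).pow_sub_one_div_sub_one m
  rwa [hm] at this

/-- A scale is the quotient of the cyclotomic unit `(ω ^ k - 1) / (ω - 1)` for `ω = -ζ_N` by the
one for `ω = ζ_N`. An even `k` is first replaced by `k + N`: then `k` is odd, hence coprime to the
order of `-ζ_N`. -/
theorem isIntegral_scale_and_inv {N k : ℕ} (hN : N ≠ 0) (hk : k.Coprime N) :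
    IsIntegral ℤ (scale N k : ℂ) ∧ IsIntegral ℤ (scale N k : ℂ)⁻¹ := by
  rw [ofReal_scale]
  set ζ := Complex.exp (2 * Real.pi * Complex.I / N)
  have hζ : ζ ^ N = 1 := (Complex.isPrimitiveRoot_exp N hN).pow_eq_one
  obtain ⟨l, hl, hlodd, hpow⟩ : ∃ l : ℕ, l.Coprime N ∧ Odd l ∧ ζ ^ k = ζ ^ l := by
    rcases Nat.even_or_odd k with he | ho
    · have hNo : Odd N := by
        rw [← Nat.not_even_iff_odd]
        intro hNe
        have := Nat.dvd_gcd he.two_dvd hNe.two_dvd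
        rw [hk] at this
        omega
      exact ⟨k + N, by simpa using hk, he.add_odd hNo, by rw [pow_add, hζ, mul_one]⟩
    · exact ⟨k, hk, ho, rfl⟩
  rw [hpow]
  have hζ' : (-ζ) ^ (2 * N) = 1 := by
    rw [pow_mul, neg_sq, ← pow_mul, mul_comm, pow_mul, hζ, one_pow]
  have hl' : l.Coprime (2 * N) := Nat.Coprime.mul_right (Nat.coprime_two_right.2 hlodd) hl
  have h1 : IsIntegral ℤ ζ := IsIntegral.of_pow (Nat.pos_of_ne_zero hN) (hζ ▸ isIntegral_one)
  have a1 := isIntegral_sub_one_div_pow_sub_one hN hζ hl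
  have a2 := h1.pow_sub_one_div_sub_one l
  have b1 := isIntegral_sub_one_div_pow_sub_one (by omega) hζ' hl'
  have b2 := h1.neg.pow_sub_one_div_sub_one l
  rw [hlodd.neg_pow, ← neg_add', ← neg_add', neg_div_neg_eq] at b1 b2
  constructor
  · rw [div_mul_div_comm, mul_comm (ζ + 1), ← div_mul_div_comm]
    exact a1.mul b2
  · rw [mul_inv, inv_div, inv_div, div_mul_div_comm, mul_comm (ζ + 1), ← div_mul_div_comm,
      mul_comm]
    exact b1.mul a2

theorem isAlgebraicUnitOf_of_isIntegral {K : IntermediateField ℚ ℝ} {x : ℝ} (hx : x ∈ K)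
    (hx0 : x ≠ 0) (h1 : IsIntegral ℤ (x : ℂ)) (h2 : IsIntegral ℤ (x : ℂ)⁻¹) :
    IsAlgebraicUnitOf K x := by
  let f : K →ₐ[ℤ] ℂ := (Complex.ofRealHom.comp (algebraMap K ℝ)).toIntAlgHom
  have hf : Function.Injective f := (Complex.ofRealHom.comp (algebraMap K ℝ)).injective
  let y : K := ⟨x, hx⟩
  have hy0 : y ≠ 0 := fun h => hx0 (congrArg Subtype.val h)
  have hy1 : IsIntegral ℤ y := (isIntegral_algHom_iff f hf).1 h1
  have hy2 : IsIntegral ℤ y⁻¹ := (isIntegral_algHom_iff f hf).1 (by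
    rw [← Complex.ofReal_inv] at h2
    exact h2)
  exact ⟨⟨⟨y, hy1⟩, ⟨y⁻¹, hy2⟩, NumberField.RingOfIntegers.ext (mul_inv_cancel₀ hy0),
    NumberField.RingOfIntegers.ext (inv_mul_cancel₀ hy0)⟩, rfl⟩

theorem Complex.im_exp_two_pi_mul_I_div_pos {N : ℕ} (hN : 3 ≤ N) :
    0 < (Complex.exp (2 * Real.pi * Complex.I / N)).im := by
  have e : 2 * Real.pi * Complex.I / N = ((2 * Real.pi / N : ℝ) : ℂ) * Complex.I := by
    push_cast; ring
  have hN' : (3 : ℝ) ≤ N := by exact_mod_cast hN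
  rw [e, Complex.exp_ofReal_mul_I_im]
  apply Real.sin_pos_of_pos_of_lt_pi (by positivity)
  rw [div_lt_iff₀ (by linarith)]
  nlinarith [Real.pi_pos]

theorem exp_pow_sub_one_ne_zero {N k : ℕ} (hN : 3 ≤ N) (hk : k.Coprime N) :
    Complex.exp (2 * Real.pi * Complex.I / N) ^ k - 1 ≠ 0 := by
  rw [sub_ne_zero]
  intro h
  have hd := ((Complex.isPrimitiveRoot_exp N (by omega)).pow_of_coprime k hk).dvd_of_pow_eq_one 1
    (by rw [h, one_pow])
  have := Nat.le_of_dvd one_pos hd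
  omega

theorem exp_pow_add_one_ne_zero {N k : ℕ} (hN : 3 ≤ N) (hk : k.Coprime N) :
    Complex.exp (2 * Real.pi * Complex.I / N) ^ k + 1 ≠ 0 := by
  intro h
  have hd := ((Complex.isPrimitiveRoot_exp N (by omega)).pow_of_coprime k hk).dvd_of_pow_eq_one 2
    (by rw [eq_neg_of_add_eq_zero_left h]; norm_num)
  have := Nat.le_of_dvd two_pos hd
  omega

theorem scale_ne_zero {N k : ℕ} (hN : 3 ≤ N) (hk : k.Coprime N) : scale N k ≠ 0 := by
  rw [← Complex.ofReal_ne_zero, ofReal_scale]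
  have h1 := exp_pow_sub_one_ne_zero hN (Nat.coprime_one_left N)
  have h2 := exp_pow_add_one_ne_zero hN (Nat.coprime_one_left N)
  rw [pow_one] at h1 h2
  exact mul_ne_zero (div_ne_zero h1 h2)
    (div_ne_zero (exp_pow_add_one_ne_zero hN hk) (exp_pow_sub_one_ne_zero hN hk))

theorem isAlgebraicUnitOf_scale {N k : ℕ} (hN : 3 ≤ N) (hk : k.Coprime N) :
    IsAlgebraicUnitOf (realCyclotomicSubfield N) (scale N k) := by
  obtain ⟨h1, h2⟩ := isIntegral_scale_and_inv (by omega) hk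
  exact isAlgebraicUnitOf_of_isIntegral (scale_mem_realCyclotomicSubfield N k)
    (scale_ne_zero hN hk) h1 h2

/-! ### The degree of the real cyclotomic field -/

theorem finrank_cyclotomicSubfield {N : ℕ} (hN : 0 < N) :
    Module.finrank ℚ (cyclotomicSubfield N) = N.totient := by
  have hζ := Complex.isPrimitiveRoot_exp N hN.ne'
  rw [cyclotomicSubfield, IntermediateField.adjoin.finrank (hζ.isIntegral hN).tower_top,
    ← Polynomial.cyclotomic_eq_minpoly_rat hζ hN, Polynomial.natDegree_cyclotomic]

/-- `(a, b) ↦ a + b ζ_N` on pairs of elements of `ℚ(ζ_N)⁺`. -/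
noncomputable def realCyclotomicPair (N : ℕ) :
    realCyclotomicSubfield N × realCyclotomicSubfield N →ₗ[ℚ] cyclotomicSubfield N where
  toFun p := ⟨p.1, p.1.2⟩ + ⟨p.2, p.2.2⟩ * IntermediateField.AdjoinSimple.gen ℚ _
  map_add' p q := by
    apply Subtype.ext
    change ((p.1 + q.1 : ℝ) : ℂ) + ((p.2 + q.2 : ℝ) : ℂ) * Complex.exp _ =
      (((p.1 : ℝ) : ℂ) + ((p.2 : ℝ) : ℂ) * Complex.exp _) +
        (((q.1 : ℝ) : ℂ) + ((q.2 : ℝ) : ℂ) * Complex.exp _)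
    push_cast
    ring
  map_smul' r p := by
    apply Subtype.ext
    change ((r • (p.1 : ℝ) : ℝ) : ℂ) + ((r • (p.2 : ℝ) : ℝ) : ℂ) * Complex.exp _ =
      r • (((p.1 : ℝ) : ℂ) + ((p.2 : ℝ) : ℂ) * Complex.exp _)
    simp only [Rat.smul_def]
    push_cast
    ring

theorem realCyclotomicPair_injective {N : ℕ} (hN : 3 ≤ N) :
    Function.Injective (realCyclotomicPair N) := by
  rw [← LinearMap.ker_eq_bot, LinearMap.ker_eq_bot']
  rintro ⟨a, b⟩ h
  have h' : ((a : ℝ) : ℂ) + ((b : ℝ) : ℂ) * Complex.exp (2 * Real.pi * Complex.I / N) = 0 :=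
    congrArg Subtype.val h
  have him := congrArg Complex.im h'
  rw [Complex.add_im, Complex.ofReal_im, zero_add, Complex.im_ofReal_mul, Complex.zero_im] at him
  have hb := (mul_eq_zero.1 him).resolve_right (Complex.im_exp_two_pi_mul_I_div_pos hN).ne'
  rw [hb, Complex.ofReal_zero, zero_mul, add_zero, Complex.ofReal_eq_zero] at h'
  exact Prod.ext (Subtype.ext h') (Subtype.ext hb)

theorem finiteDimensional_realCyclotomicSubfield {N : ℕ} (hN : 3 ≤ N) :
    FiniteDimensional ℚ (realCyclotomicSubfield N) := by
  have : FiniteDimensional ℚ (cyclotomicSubfield N) :=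
    Module.finite_of_finrank_pos (by
      rw [finrank_cyclotomicSubfield (by omega)]
      exact Nat.totient_pos.2 (by omega))
  exact FiniteDimensional.of_injective
    ((realCyclotomicPair N).comp (LinearMap.inl ℚ _ _))
    ((realCyclotomicPair_injective hN).comp LinearMap.inl_injective)

theorem two_mul_finrank_realCyclotomicSubfield_le {N : ℕ} (hN : 3 ≤ N) :
    2 * Module.finrank ℚ (realCyclotomicSubfield N) ≤ N.totient := by
  have := finiteDimensional_realCyclotomicSubfield hN
  have : FiniteDimensional ℚ (cyclotomicSubfield N) :=
    Module.finite_of_finrank_pos (by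
      rw [finrank_cyclotomicSubfield (by omega)]
      exact Nat.totient_pos.2 (by omega))
  have h := LinearMap.finrank_le_finrank_of_injective (realCyclotomicPair_injective hN)
  rw [Module.finrank_prod, finrank_cyclotomicSubfield (by omega)] at h
  omega

/-! ### The basis of primitive scales -/

theorem PrimitiveIndex.two_mul_lt {N : ℕ} (k : PrimitiveIndex N) : 2 * (k : ℕ) < N := by
  have h := k.2.2.1
  rw [lt_div_iff₀ two_pos] at h
  have h' : (k : ℕ) * 2 < N := by exact_mod_cast h
  omega

instance PrimitiveIndex.finite (N : ℕ) : Finite (PrimitiveIndex N) :=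
  Finite.of_injective (fun k : PrimitiveIndex N => (⟨k, by
    have := k.two_mul_lt; omega⟩ : Fin N)) fun i j h => Subtype.ext (congrArg Fin.val h)

/-- A primitive index as a unit modulo `N`. -/
def PrimitiveIndex.toUnit {N : ℕ} (k : PrimitiveIndex N) : (ZMod N)ˣ :=
  ZMod.unitOfCoprime k k.2.2.2

theorem PrimitiveIndex.toUnit_injective (N : ℕ) :
    Function.Injective (PrimitiveIndex.toUnit (N := N)) := by
  intro i j h
  have h' : ((i : ℕ) : ZMod N) = ((j : ℕ) : ZMod N) := congrArg Units.val h
  rw [ZMod.natCast_eq_natCast_iff'] at h'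
  have hi := i.two_mul_lt
  have hj := j.two_mul_lt
  rw [Nat.mod_eq_of_lt (by omega), Nat.mod_eq_of_lt (by omega)] at h'
  exact Subtype.ext h'

theorem PrimitiveIndex.toUnit_ne_neg {N : ℕ} (i j : PrimitiveIndex N) :
    i.toUnit ≠ -j.toUnit := by
  intro h
  have h' : ((i : ℕ) : ZMod N) = -((j : ℕ) : ZMod N) := congrArg Units.val h
  rw [eq_neg_iff_add_eq_zero, ← Nat.cast_add, ZMod.natCast_eq_zero_iff] at h'
  have hi := i.two_mul_lt
  have hj := j.two_mul_lt
  have := i.2.1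
  have := Nat.le_of_dvd (by omega) h'
  omega

/-- Every unit modulo `N` is, up to sign, a primitive index. -/
theorem PrimitiveIndex.totient_le {N : ℕ} (hN : 3 ≤ N) :
    N.totient ≤ 2 * Nat.card (PrimitiveIndex N) := by
  have : NeZero N := ⟨by omega⟩
  have hsurj : Function.Surjective
      (Sum.elim (PrimitiveIndex.toUnit (N := N))
        fun k : PrimitiveIndex N => -PrimitiveIndex.toUnit k) := by
    intro u
    have hlt := ZMod.val_lt (u : ZMod N)
    have hc := ZMod.val_coe_unit_coprime u
    have hne : 2 * (u : ZMod N).val ≠ N := by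
      intro h
      have := Nat.Coprime.eq_one_of_dvd hc ⟨2, by omega⟩
      omega
    have hne0 : (u : ZMod N).val ≠ 0 := by
      intro h
      rw [h, Nat.coprime_zero_left] at hc
      omega
    have half : ∀ m : ℕ, 2 * m < N → (m : ℝ) < (N : ℝ) / 2 := fun m hm => by
      rw [lt_div_iff₀ two_pos, mul_comm]
      exact_mod_cast hm
    rcases lt_or_gt_of_ne hne with h | h
    · refine ⟨Sum.inl ⟨(u : ZMod N).val, by omega, half _ h, hc⟩, Units.ext ?_⟩
      simp [PrimitiveIndex.toUnit]
    · refine ⟨Sum.inr ⟨N - (u : ZMod N).val, by omega, half _ (by omega), ?_⟩, Units.ext ?_⟩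
      · exact (Nat.coprime_self_sub_left hlt.le).2 hc
      · simp [PrimitiveIndex.toUnit, Nat.cast_sub hlt.le]
  have h := Nat.card_le_card_of_surjective _ hsurj
  rw [Nat.card_sum, Nat.card_eq_fintype_card, ZMod.card_units_eq_totient] at h
  omega

theorem linearIndependent_scale {N : ℕ} (hN : 3 ≤ N) :
    LinearIndependent ℚ fun k : PrimitiveIndex N =>
      (⟨scale N k, scale_mem_realCyclotomicSubfield N k⟩ : realCyclotomicSubfield N) := by
  have : NeZero N := ⟨by omega⟩
  have h := linearIndependent_cotRatio PrimitiveIndex.toUnit (PrimitiveIndex.toUnit_injective N)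
    PrimitiveIndex.toUnit_ne_neg
  set ζ := Complex.exp (2 * Real.pi * Complex.I / N) with hζ
  have h1 : ζ - 1 ≠ 0 := by simpa using exp_pow_sub_one_ne_zero hN (Nat.coprime_one_left N)
  have h2 : ζ + 1 ≠ 0 := by simpa using exp_pow_add_one_ne_zero hN (Nat.coprime_one_left N)
  have h3 := h.map' (LinearMap.mulLeft ℚ ((ζ - 1) / (ζ + 1)))
    (LinearMap.ker_eq_bot.2 (mul_right_injective₀ (div_ne_zero h1 h2)))
  let f : realCyclotomicSubfield N →ₗ[ℚ] ℂ :=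
    ((Complex.ofRealAm.restrictScalars ℚ).comp (realCyclotomicSubfield N).val).toLinearMap
  have hf : (f ∘ fun k : PrimitiveIndex N =>
      (⟨scale N k, scale_mem_realCyclotomicSubfield N k⟩ : realCyclotomicSubfield N)) =
      LinearMap.mulLeft ℚ ((ζ - 1) / (ζ + 1)) ∘ fun k : PrimitiveIndex N =>
        cotRatio (PrimitiveIndex.toUnit k : ZMod N) := by
    ext k
    have e : (ZMod.stdAddChar (((k : ℕ) : ZMod N)) : ℂ) = ζ ^ (k : ℕ) := by
      rw [← Int.cast_natCast, ZMod.stdAddChar_coe, hζ, ← Complex.exp_nat_mul]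
      congr 1
      push_cast
      ring
    change ((scale N k : ℝ) : ℂ) = (ζ - 1) / (ζ + 1) * cotRatio (((k : ℕ) : ZMod N))
    rw [cotRatio, e, ofReal_scale]
  exact LinearIndependent.of_comp f (hf ▸ h3)

theorem exists_basis_scale {N : ℕ} (hN : 3 ≤ N) :
    ∃ b : Module.Basis (PrimitiveIndex N) ℚ (realCyclotomicSubfield N),
      ∀ k : PrimitiveIndex N, (b k : ℝ) = scale N k := by
  have := finiteDimensional_realCyclotomicSubfield hN
  have := Fintype.ofFinite (PrimitiveIndex N)
  have : Nonempty (PrimitiveIndex N) := ⟨⟨1, le_rfl, by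
    rw [lt_div_iff₀ two_pos]; norm_num; exact_mod_cast (by omega : 2 < N),
    Nat.coprime_one_left N⟩⟩
  have hli := linearIndependent_scale hN
  have hcard : Fintype.card (PrimitiveIndex N) =
      Module.finrank ℚ (realCyclotomicSubfield N) := by
    have h1 := hli.fintype_card_le_finrank
    have h2 := PrimitiveIndex.totient_le hN
    have h3 := two_mul_finrank_realCyclotomicSubfield_le hN
    rw [Nat.card_eq_fintype_card] at h2
    omega
  exact ⟨basisOfLinearIndependentOfCardEqFinrank hli hcard, fun k => by simp⟩

/-! ### Generators of the real cyclotomic field -/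

/-- `ℚ(ζ_N)⁺` is generated by `cos (2π / N)`: a real polynomial expression in `ζ_N` is a
combination of the real parts of the powers of `ζ_N`, which satisfy the Chebyshev recursion. -/
theorem realCyclotomicSubfield_le_adjoin_cos {N : ℕ} (hN : 0 < N) :
    realCyclotomicSubfield N ≤ ℚ⟮Real.cos (2 * Real.pi / N)⟯ := by
  intro x hx
  rw [mem_realCyclotomicSubfield, cyclotomicSubfield] at hx
  have e : 2 * Real.pi * Complex.I / N = ((2 * Real.pi / N : ℝ) : ℂ) * Complex.I := by
    push_cast; ring
  have hint : IsIntegral ℚ (Complex.exp (2 * Real.pi * Complex.I / N)) :=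
    ((Complex.isPrimitiveRoot_exp N hN.ne').isIntegral hN).tower_top
  rw [← IntermediateField.mem_toSubalgebra,
    IntermediateField.adjoin_simple_toSubalgebra_of_isAlgebraic hint.isAlgebraic,
    Algebra.adjoin_singleton_eq_range_aeval] at hx
  obtain ⟨p, hp⟩ := hx
  have hc : Real.cos (2 * Real.pi / N) ∈ ℚ⟮Real.cos (2 * Real.pi / N)⟯ :=
    IntermediateField.mem_adjoin_simple_self ℚ _
  have hcos : ∀ n : ℕ, Real.cos (n * (2 * Real.pi / N)) ∈ ℚ⟮Real.cos (2 * Real.pi / N)⟯ := by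
    intro n
    induction n using Nat.twoStepInduction with
    | zero => simp
    | one => simpa using hc
    | more n ih1 ih2 =>
      have h := Real.cos_add_cos ((n + 2 : ℕ) * (2 * Real.pi / N)) (n * (2 * Real.pi / N))
      have e1 : (((n + 2 : ℕ) : ℝ) * (2 * Real.pi / N) + n * (2 * Real.pi / N)) / 2 =
          (n + 1 : ℕ) * (2 * Real.pi / N) := by push_cast; ring
      have e2 : (((n + 2 : ℕ) : ℝ) * (2 * Real.pi / N) - n * (2 * Real.pi / N)) / 2 =
          2 * Real.pi / N := by push_cast; ring
      rw [e1, e2] at h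
      rw [eq_sub_of_add_eq h]
      exact sub_mem (mul_mem (mul_mem (ofNat_mem _ 2) ih2) hc) ih1
  have hre : x = ∑ n ∈ Finset.range (p.natDegree + 1),
      (p.coeff n : ℝ) * Real.cos (n * (2 * Real.pi / N)) := by
    have h := congrArg Complex.re hp
    rw [Complex.ofReal_re] at h
    rw [← h]
    change (Polynomial.aeval (Complex.exp (2 * Real.pi * Complex.I / N)) p).re = _
    rw [Polynomial.aeval_eq_sum_range, Complex.re_sum]
    refine Finset.sum_congr rfl fun n _ => ?_
    rw [← Complex.exp_nat_mul, e, ← mul_assoc, Rat.smul_def]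
    have e3 : ((n : ℂ) * ((2 * Real.pi / N : ℝ) : ℂ)) = ((n * (2 * Real.pi / N) : ℝ) : ℂ) := by
      push_cast; rfl
    rw [e3, ← Complex.ofReal_ratCast, Complex.re_ofReal_mul, Complex.exp_ofReal_mul_I_re]
  rw [hre]
  exact sum_mem fun n _ => mul_mem (SubfieldClass.ratCast_mem _ _) (hcos n)

theorem isUnitGeneratorOf_scale {N k : ℕ} (hN : 3 ≤ N) (hk : k.Coprime N)
    (hcos : Real.cos (2 * Real.pi / N) ∈ ℚ⟮scale N k⟯) :
    IsUnitGeneratorOf (realCyclotomicSubfield N) (scale N k) :=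
  ⟨isAlgebraicUnitOf_scale hN hk, le_antisymm
    (IntermediateField.adjoin_simple_le_iff.2 (scale_mem_realCyclotomicSubfield N k))
    ((realCyclotomicSubfield_le_adjoin_cos (by omega)).trans
      (IntermediateField.adjoin_simple_le_iff.2 hcos))⟩

theorem cos_pi_div_pos {N : ℕ} (hN : 3 ≤ N) : 0 < Real.cos (Real.pi / N) := by
  have hN' : (3 : ℝ) ≤ N := by exact_mod_cast hN
  have : Real.pi / N < Real.pi / 2 := by
    apply div_lt_div_of_pos_left Real.pi_pos two_pos
    linarith
  exact Real.cos_pos_of_mem_Ioo ⟨by linarith [Real.pi_pos, (by positivity : 0 ≤ Real.pi / N)], this⟩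

/-- The last index is `N / 2 - 1 / 2`, so `GenScale[N] = tan (2 x) tan x` with `x = π / (2 N)`. -/
theorem genScale_of_odd {N : ℕ} (hN : 3 ≤ N) (ho : Odd N) :
    genScale N = 1 / Real.cos (Real.pi / N) - 1 := by
  obtain ⟨m, hm⟩ := ho
  have hl : lastIndex N = m := by unfold lastIndex; omega
  have hN0 : (N : ℝ) ≠ 0 := by positivity
  have e1 : (m : ℝ) * Real.pi / N = Real.pi / 2 - Real.pi / N / 2 := by
    have : (N : ℝ) = 2 * m + 1 := by exact_mod_cast hm
    field_simp
    rw [this]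
    ring
  have hc := cos_pi_div_pos hN
  have h2 := Real.cos_two_mul (Real.pi / N / 2)
  have h3 := Real.sin_two_mul (Real.pi / N / 2)
  have h4 := Real.sin_sq_add_cos_sq (Real.pi / N / 2)
  rw [mul_div_cancel₀ _ two_ne_zero] at h2 h3
  have hc2 : Real.cos (Real.pi / N / 2) ≠ 0 := by
    apply (Real.cos_pos_of_mem_Ioo ⟨_, _⟩).ne'
    · linarith [Real.pi_pos, (by positivity : 0 ≤ Real.pi / N)]
    · have : Real.pi / N ≤ Real.pi := div_le_self Real.pi_pos.le (by
        exact_mod_cast (by omega : 1 ≤ N))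
      linarith [Real.pi_pos, (by positivity : 0 < Real.pi / N),
        div_lt_self Real.pi_pos (show (1 : ℝ) < N by exact_mod_cast (by omega : 1 < N))]
  rw [genScale, scale, hl, starPoint, starPoint, Nat.cast_one, one_mul, e1,
    Real.tan_pi_div_two_sub, div_inv_eq_mul, Real.tan_eq_sin_div_cos, Real.tan_eq_sin_div_cos, h3]
  generalize Real.cos (Real.pi / N) = c at *
  generalize Real.pi / N / 2 = x at *
  field_simp
  linear_combination 2 * h4 + h2

/-- The last index is `N / 2 - 1`, complementary to the first one. -/
theorem genScale_of_four_dvd {N : ℕ} (hN : 0 < N) (h4 : 4 ∣ N) :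
    genScale N = Real.tan (Real.pi / N) ^ 2 := by
  obtain ⟨m, hm⟩ := h4
  have hl : lastIndex N = 2 * m - 1 := by unfold lastIndex; omega
  have hN0 : (N : ℝ) ≠ 0 := by positivity
  have e1 : ((2 * m - 1 : ℕ) : ℝ) * Real.pi / N = Real.pi / 2 - Real.pi / N := by
    rw [Nat.cast_sub (by omega)]
    have : (N : ℝ) = 4 * m := by exact_mod_cast hm
    push_cast
    field_simp
    rw [this]
    ring
  rw [genScale, scale, hl, starPoint, starPoint, Nat.cast_one, one_mul, e1,
    Real.tan_pi_div_two_sub, div_inv_eq_mul, sq]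

theorem isUnitGeneratorOf_genScale {N : ℕ} (hN : 3 ≤ N) (h : ¬ N ≡ 2 [MOD 4]) :
    IsUnitGeneratorOf (realCyclotomicSubfield N) (genScale N) := by
  have hc := cos_pi_div_pos hN
  have hself : genScale N ∈ ℚ⟮genScale N⟯ := IntermediateField.mem_adjoin_simple_self ℚ _
  rcases Nat.even_or_odd N with he | ho
  · have h4 : 4 ∣ N := by
      have := he.two_dvd
      unfold Nat.ModEq at h
      omega
    refine isUnitGeneratorOf_scale hN ?_ ?_
    · obtain ⟨m, rfl⟩ := h4
      have hl : lastIndex (4 * m) = 2 * m - 1 := by unfold lastIndex; omega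
      have hodd : (2 * m - 1).Coprime 2 := Nat.coprime_two_right.2 ⟨m - 1, by omega⟩
      have hm : (2 * m - 1).Coprime (2 * m) := by
        have := (Nat.coprime_self_sub_left (n := 2 * m) (m := 1) (by omega)).2
          (Nat.coprime_one_left _)
        exact this
      rw [hl, show 4 * m = 2 * (2 * m) by ring]
      exact hodd.mul_right hm
    · change _ ∈ ℚ⟮genScale N⟯
      have hg := genScale_of_four_dvd (by omega) h4
      have e : Real.cos (2 * Real.pi / N) = (1 - genScale N) / (1 + genScale N) := by
        have h1 : 1 + genScale N = (Real.cos (Real.pi / N) ^ 2)⁻¹ := by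
          rw [hg, ← Real.inv_one_add_tan_sq hc.ne', inv_inv]
        rw [h1, div_inv_eq_mul, hg, Real.tan_eq_sin_div_cos, mul_div_assoc, Real.cos_two_mul']
        field_simp
      rw [e]
      exact div_mem (sub_mem (one_mem _) hself) (add_mem (one_mem _) hself)
  · refine isUnitGeneratorOf_scale hN ?_ ?_
    · obtain ⟨m, rfl⟩ := ho
      have hl : lastIndex (2 * m + 1) = m := by unfold lastIndex; omega
      rw [hl]
      simp
    · change _ ∈ ℚ⟮genScale N⟯
      have hg := genScale_of_odd hN ho
      have e : Real.cos (2 * Real.pi / N) = 2 * (1 / (genScale N + 1)) ^ 2 - 1 := by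
        rw [hg, sub_add_cancel, one_div_one_div, mul_div_assoc, Real.cos_two_mul]
      rw [e]
      exact sub_mem (mul_mem (ofNat_mem _ 2)
        (pow_mem (div_mem (one_mem _) (add_mem hself (one_mem _))) 2)) (one_mem _)

/-- For odd `M` the `2M`-th and `M`-th cyclotomic fields agree, since `-1` is rational. -/
theorem cyclotomicSubfield_two_mul {M : ℕ} (hM : Odd M) :
    cyclotomicSubfield (2 * M) = cyclotomicSubfield M := by
  have hM0 : (M : ℂ) ≠ 0 := Nat.cast_ne_zero.2 hM.pos.ne'
  apply le_antisymm
  · refine IntermediateField.adjoin_simple_le_iff.2 ?_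
    obtain ⟨m, hm⟩ := hM
    have hm' : (M : ℂ) = 2 * m + 1 := by exact_mod_cast hm
    have e : Complex.exp (2 * Real.pi * Complex.I / (2 * M : ℕ)) =
        -Complex.exp (2 * Real.pi * Complex.I / M) ^ (m + 1) := by
      rw [← Complex.exp_nat_mul, show ((m + 1 : ℕ) : ℂ) * (2 * Real.pi * Complex.I / M) =
        2 * Real.pi * Complex.I / (2 * M : ℕ) + Real.pi * Complex.I by
          push_cast
          field_simp
          rw [hm']
          ring, Complex.exp_add, Complex.exp_pi_mul_I]
      ring
    rw [e]
    exact neg_mem (pow_mem (IntermediateField.mem_adjoin_simple_self ℚ _) _)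
  · refine IntermediateField.adjoin_simple_le_iff.2 ?_
    have e : Complex.exp (2 * Real.pi * Complex.I / M) =
        Complex.exp (2 * Real.pi * Complex.I / (2 * M : ℕ)) ^ 2 := by
      rw [← Complex.exp_nat_mul]
      congr 1
      push_cast
      field_simp
    rw [e]
    exact pow_mem (IntermediateField.mem_adjoin_simple_self ℚ _) _

/-! ### Primitive scales and unit generators -/

theorem mainTheorem2 (N : ℕ) (hN : 3 ≤ N) :
    (∀ k : PrimitiveIndex N, scale N k ∈ realCyclotomicSubfield N) ∧
    (∃ b : Module.Basis (PrimitiveIndex N) ℚ (realCyclotomicSubfield N),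
      ∀ k : PrimitiveIndex N, (b k : ℝ) = scale N k) ∧
    (∀ k : PrimitiveIndex N, IsAlgebraicUnitOf (realCyclotomicSubfield N) (scale N k)) ∧
    (¬ N ≡ 2 [MOD 4] → IsUnitGeneratorOf (realCyclotomicSubfield N) (genScale N)) ∧
    (N ≡ 2 [MOD 4] → IsUnitGeneratorOf (realCyclotomicSubfield N) (genScale (N / 2))) := by
  refine ⟨fun k => scale_mem_realCyclotomicSubfield N k, exists_basis_scale hN,
    fun k => isAlgebraicUnitOf_scale hN k.2.2.2, isUnitGeneratorOf_genScale hN, fun h => ?_⟩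
  unfold Nat.ModEq at h
  obtain ⟨M, rfl⟩ : ∃ M, N = 2 * M := ⟨N / 2, by omega⟩
  rw [Nat.mul_div_cancel_left M two_pos, realCyclotomicSubfield,
    cyclotomicSubfield_two_mul ⟨M / 2, by omega⟩]
  exact isUnitGeneratorOf_genScale (by omega) (by unfold Nat.ModEq; omega)
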